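/- Let $\mathbb N^*$ be the set of positive integers and let $\mu=(\mu_i)_{i\in I}\colon I\to\mathbb N^*$ be a signature, where $I$ is an arbitrary set. A relational structure $\mathfrak A$ of signature $\mu$ is a (possibly empty) set $A$ together with a relation $R_i^{\mathfrak A}\subseteq A^{\mu_i}$ for each $i\in I$. An embedding of $\mathfrak A$ into $\mathfrak B$ is an isomorphism of $\mathfrak A$ onto an induced substructure of $\mathfrak B$. Let $\Omega_\mu$ be the set of isomorphism types of finite relational structures of signature $\mu$, partially ordered by embeddability. The age of a relational structure $\mathfrak A$ of signature $\mu$ is the set of isomorphism types of its finite induced substructures. An ideal of $\Omega_\mu$ is a non-empty, downward closed, up-directed subset of $\Omega_\mu$; it is representable if it is the age of some (finite or infinite) relational structure of signature $\mu$. Then the following statements are equivalent: 1. Every ideal of $\Omega_\mu$ is representable. 2. The set $\mu^{-1}[\mathbb N^*\setminus\{1\}]=\{i\in I:\mu_i\ge 2\}$ is finite. 3. The set of all ideals of $\Omega_\mu$, as a subset of the power set $\mathfrak P(\Omega_\mu)=\{0,1\}^{\Omega_\mu}$ equipped with the product topology ($\{0,1\}$ being discrete), is compact. -/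

import Mathlib

universe u w

/-- The relational language of a signature `μ : I → ℕ+`: there are no function symbols (hence no
constants), and each index `i` is a relation symbol of arity `μ i`. -/
def sigLang {I : Type u} (μ : I → ℕ+) : FirstOrder.Language.{0, u} where
  Functions := fun _ => Empty
  Relations := fun n => {i : I // (μ i : ℕ) = n}

/-- A concrete finite structure of signature `μ`, with base set `{0, …, size - 1}`; the empty
structure is included.  Every finite structure is isomorphic to one of these. -/
structure FinStr {I : Type u} (μ : I → ℕ+) : Type u where
  size : ℕ
  str : (sigLang μ).Structure (Fin size)

namespace FinStr

variable {I : Type u} {μ : I → ℕ+}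

/-- The base set. -/
def Carrier (S : FinStr μ) : Type := Fin S.size

instance (S : FinStr μ) : Fintype S.Carrier := inferInstanceAs (Fintype (Fin S.size))

instance (S : FinStr μ) : (sigLang μ).Structure S.Carrier := S.str

/-- Being isomorphic. -/
instance isoSetoid (μ : I → ℕ+) : Setoid (FinStr μ) where
  r S T := Nonempty (FirstOrder.Language.Equiv (sigLang μ) S.Carrier T.Carrier)
  iseqv :=
    { refl := fun S => ⟨FirstOrder.Language.Equiv.refl (sigLang μ) S.Carrier⟩
      symm := fun ⟨e⟩ => ⟨e.symm⟩
      trans := fun ⟨e⟩ ⟨f⟩ => ⟨f.comp e⟩ }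

/-- Embeddability: `S` is isomorphic to an induced substructure of `T`. -/
def Embeds (S T : FinStr μ) : Prop :=
  Nonempty (FirstOrder.Language.Embedding (sigLang μ) S.Carrier T.Carrier)

theorem Embeds.trans {S T U : FinStr μ} : S.Embeds T → T.Embeds U → S.Embeds U :=
  fun ⟨f⟩ ⟨g⟩ => ⟨g.comp f⟩

theorem embeds_of_equiv {S T : FinStr μ} (h : S ≈ T) : S.Embeds T :=
  h.elim fun e => ⟨e.toEmbedding⟩

theorem Embeds.antisymm {S T : FinStr μ} : S.Embeds T → T.Embeds S → S ≈ T := by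
  rintro ⟨f⟩ ⟨g⟩
  have hc : Fintype.card S.Carrier = Fintype.card T.Carrier :=
    le_antisymm (Fintype.card_le_of_injective f f.injective)
      (Fintype.card_le_of_injective g g.injective)
  have hb : Function.Bijective f := (Fintype.bijective_iff_injective_and_card f).2 ⟨f.injective, hc⟩
  exact ⟨{ toEquiv := Equiv.ofBijective f hb
           map_fun' := fun h => Empty.elim h
           map_rel' := fun r x => f.map_rel r x }⟩

end FinStr

/-- The poset `Ω_μ` of isomorphism types of finite structures of signature `μ`, ordered by
embeddability. -/
def FinIsoType {I : Type u} (μ : I → ℕ+) : Type u := Quotient (FinStr.isoSetoid μ)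

instance {I : Type u} (μ : I → ℕ+) : PartialOrder (FinIsoType μ) where
  le := Quotient.lift₂ FinStr.Embeds fun _ _ _ _ h k => propext
    ⟨fun e => (FinStr.embeds_of_equiv (Setoid.symm h)).trans (e.trans (FinStr.embeds_of_equiv k)),
      fun e => (FinStr.embeds_of_equiv h).trans
        (e.trans (FinStr.embeds_of_equiv (Setoid.symm k)))⟩
  le_refl s := Quotient.inductionOn s fun S => FinStr.embeds_of_equiv (Setoid.refl S)
  le_trans s t v := Quotient.inductionOn₃ s t v fun _ _ _ h k => FinStr.Embeds.trans h k
  le_antisymm s t := Quotient.inductionOn₂ s t fun _ _ h k =>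
    Quotient.sound (FinStr.Embeds.antisymm h k)

/-- The age of a structure: the set of isomorphism types of its finite induced substructures.
Since there are no function symbols, every subset of `A` is the base set of a substructure. -/
def relAge {I : Type u} (μ : I → ℕ+) (A : Type w) [(sigLang μ).Structure A] :
    Set (FinIsoType μ) :=
  {s | ∃ F : (sigLang μ).Substructure A, (F : Set A).Finite ∧
    ∃ S : FinStr μ, s = Quotient.mk _ S ∧ Nonempty (FirstOrder.Language.Equiv (sigLang μ) S.Carrier F)}

/-- A set of isomorphism types is representable if it is the age of some structure. A structure
in a higher universe whose age is the given set has a substructure with the same age and at most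
`ℵ₀ + 2 ^ |I|` elements (a union of one copy of each member), so nothing is lost by taking
base sets in the universe of `I`. -/
def IsRepresentable {I : Type u} {μ : I → ℕ+} (J : Set (FinIsoType μ)) : Prop :=
  ∃ (A : Type u) (_ : (sigLang μ).Structure A), relAge μ A = J

open Classical in
/-- The product topology on the power set of `P`, which is identified with `{0,1}^P`
(`{0,1}` discrete) through characteristic functions. -/
@[reducible] noncomputable def powersetTopology (P : Type w) : TopologicalSpace (Set P) :=
  TopologicalSpace.induced (fun (X : Set P) (p : P) => decide (p ∈ X))
    (inferInstance : TopologicalSpace (P → Bool))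

/-! If only finitely many relations are not unary, then every ideal `J` is the age of a limit of its
members along an ultrafilter on `J` (`isRepresentable_of_finite`). Moreover any two finite
structures then have finitely many upper bounds such that every upper bound lies above one of these
(`exists_finite_upperBounds`): the unary relations of a structure covered by copies of `S` and `T`
are determined by `S` and `T`, which leaves finitely many choices. Hence being directed is, like the
other two conditions on ideals, a closed condition on subsets of `Ω_μ`, and closed sets in `{0,1}^Ω_μ`
are compact (`isClosed_isIdeal`).

Suppose now that infinitely many relations are not unary, and let `N` be the set of their indices.

The indices in `N` can serve as colours of pairs: `(x, y)` has colour `i` if the tuple `(x, y, …, y)`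
is in the relation `i`. The finite structures in which every pair has one colour, with different
colours on the pairs that start at the same point, form an ideal, since there are always new colours
for the pairs across a disjoint union. In a structure with this age, a point is determined by the
colour of the pair that a fixed point forms with it, so there are at most `|N|` points. But the
values of the relations in `N` on constant tuples `(x, …, x)` are arbitrary, so at least `2 ^ |N|`
points are needed (`not_isRepresentable_properlyColoredTypes`).

As for compactness, take a point `x` with no relations and a point `y` with all of them, and for each
`i ∈ N` the structure on `{x, y}` whose non-constant tuples are in the relation `i` alone. The
principal ideals of these structures converge to the set consisting of the empty structure and the
two points, which is not directed. So the set of ideals is not closed, and in a Hausdorff space it is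
then not compact (`not_isClosed_isIdeal`). -/

/-! ### Structures as families of relations -/

/-- A family of relations on `A`, one of arity `μ i` for each `i`: the data of a relational structure
of signature `μ` on `A`, kept unbundled so that one set can carry several of them. -/
abbrev RelFam {I : Type u} (μ : I → ℕ+) (A : Type w) : Type (max u w) :=
  ∀ i, (Fin (μ i) → A) → Prop

section Basic

universe v v'

variable {I : Type u} {μ : I → ℕ+} {A : Type w} {B : Type v} {C : Type v'}

/-- `f` is an embedding of the structure `R` into the structure `R'`. -/
def IsEmb (R : RelFam μ A) (R' : RelFam μ B) (f : A → B) : Prop :=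
  Function.Injective f ∧ ∀ i v, R' i (f ∘ v) ↔ R i v

theorem IsEmb.comp {R : RelFam μ A} {R' : RelFam μ B} {R'' : RelFam μ C} {f : A → B} {g : B → C}
    (hg : IsEmb R' R'' g) (hf : IsEmb R R' f) : IsEmb R R'' (g ∘ f) :=
  ⟨hg.1.comp hf.1, fun i v => (hg.2 i (f ∘ v)).trans (hf.2 i v)⟩

/-- The family of relations of a first-order structure over `sigLang μ`. -/
def relOf (μ : I → ℕ+) (A : Type w) [(sigLang μ).Structure A] : RelFam μ A :=
  fun i v => FirstOrder.Language.Structure.RelMap (L := sigLang μ) (n := μ i) ⟨i, rfl⟩ v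

/-- The first-order structure over `sigLang μ` with a given family of relations. -/
@[reducible] def strOf (R : RelFam μ A) : (sigLang μ).Structure A where
  funMap := fun h => Empty.elim h
  RelMap := fun r v => R r.1 (v ∘ Fin.cast r.2)

theorem nonempty_embedding_iff [(sigLang μ).Structure A] [(sigLang μ).Structure B] :
    Nonempty (FirstOrder.Language.Embedding (sigLang μ) A B) ↔
      ∃ f, IsEmb (relOf μ A) (relOf μ B) f := by
  constructor
  · rintro ⟨f⟩
    exact ⟨f, f.injective, fun i v => f.map_rel _ v⟩
  · rintro ⟨f, hf, h⟩
    refine ⟨⟨⟨f, hf⟩, fun h => Empty.elim h, ?_⟩⟩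
    rintro n ⟨i, rfl⟩ v
    exact h i v

/-- The relations of a finite structure. -/
def FinStr.rel (S : FinStr μ) : RelFam μ S.Carrier := relOf μ S.Carrier

/-- The isomorphism type of a finite structure. -/
def FinStr.isoType (S : FinStr μ) : FinIsoType μ := Quotient.mk _ S

theorem FinIsoType.exists_isoType_eq (s : FinIsoType μ) : ∃ S : FinStr μ, S.isoType = s :=
  Quotient.exists_rep s

theorem FinStr.isoType_le_iff {S T : FinStr μ} :
    S.isoType ≤ T.isoType ↔ ∃ f, IsEmb S.rel T.rel f :=
  nonempty_embedding_iff

/-- Every structure on a finite set is isomorphic to one on some `{0, …, n - 1}`. -/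
theorem exists_finStr [Finite A] (R : RelFam μ A) :
    ∃ (S : FinStr μ) (e : A ≃ S.Carrier), IsEmb R S.rel e ∧ IsEmb S.rel R e.symm := by
  obtain ⟨n, ⟨e⟩⟩ := Finite.exists_equiv_fin A
  refine ⟨⟨n, strOf fun i v => R i (e.symm ∘ v)⟩, e, ⟨e.injective, fun i v => ?_⟩,
    ⟨e.symm.injective, fun i v => Iff.rfl⟩⟩
  change R i (e.symm ∘ e ∘ v) ↔ R i v
  rw [← Function.comp_assoc, e.symm_comp_self, Function.id_comp]

theorem exists_finStr_range_eq (R : RelFam μ A) {F : Set A} (hF : F.Finite) :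
    ∃ (S : FinStr μ) (f : S.Carrier → A), IsEmb S.rel R f ∧ Set.range f = F := by
  have := hF.to_subtype
  obtain ⟨S, e, -, he⟩ := exists_finStr (μ := μ) (A := F) fun i v => R i (Subtype.val ∘ v)
  refine ⟨S, Subtype.val ∘ e.symm, IsEmb.comp ⟨Subtype.val_injective, fun _ _ => Iff.rfl⟩ he, ?_⟩
  rw [Set.range_comp, e.symm.range_eq_univ, Set.image_univ, Subtype.range_coe]

theorem isoType_mem_relAge_iff [(sigLang μ).Structure A] {S : FinStr μ} :
    S.isoType ∈ relAge μ A ↔ ∃ f, IsEmb S.rel (relOf μ A) f := by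
  refine Iff.trans ?_ nonempty_embedding_iff
  constructor
  · rintro ⟨F, -, T, hST, ⟨e⟩⟩
    obtain ⟨e'⟩ := Quotient.exact hST
    exact ⟨F.subtype.comp (e.comp e').toEmbedding⟩
  · rintro ⟨f⟩
    refine ⟨f.toHom.range, ?_, S, rfl, ⟨f.equivRange⟩⟩
    rw [FirstOrder.Language.Hom.range_coe]
    exact Set.finite_range _

theorem isRepresentable_iff {J : Set (FinIsoType μ)} :
    IsRepresentable J ↔ ∃ (A : Type u) (R : RelFam μ A),
      ∀ S : FinStr μ, S.isoType ∈ J ↔ ∃ f, IsEmb S.rel R f := by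
  constructor
  · rintro ⟨A, _, rfl⟩
    exact ⟨A, relOf μ A, fun S => isoType_mem_relAge_iff⟩
  · rintro ⟨A, R, h⟩
    refine ⟨A, strOf R, Set.ext fun s => ?_⟩
    obtain ⟨S, rfl⟩ := s.exists_isoType_eq
    let := strOf R
    exact isoType_mem_relAge_iff.trans (h S).symm

/-- The tuple `(x, y, …, y)` of length `n`. -/
def headTail (n : ℕ) (x y : A) : Fin n → A := fun k => if k.val = 0 then x else y

theorem comp_headTail (f : A → B) (n : ℕ) (x y : A) :
    f ∘ headTail n x y = headTail n (f x) (f y) :=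
  funext fun _ => apply_ite f _ _ _

theorem exists_eq_const {n : ℕ+} (hn : n = 1) (v : Fin n → A) : ∃ x, v = fun _ => x := by
  subst hn
  exact ⟨v 0, funext fun k => congrArg v (Subsingleton.elim (α := Fin 1) k 0)⟩

theorem two_le_of_ne_one {n : ℕ+} (hn : n ≠ 1) : 2 ≤ (n : ℕ) := by
  have h1 := n.pos
  have h2 : (n : ℕ) ≠ 1 := fun h => hn (PNat.coe_eq_one_iff.1 h)
  omega

theorem exists_headTail {n : ℕ+} (hn : n ≠ 1) :
    ∃ k l : Fin n, ∀ (A : Type w) (x y : A), headTail n x y k = x ∧ headTail n x y l = y :=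
  ⟨⟨0, n.pos⟩, ⟨1, two_le_of_ne_one hn⟩, fun _ _ _ => ⟨if_pos rfl, if_neg one_ne_zero⟩⟩

theorem headTail_inj {n : ℕ+} (hn : n ≠ 1) {x y x' y' : A} :
    headTail n x y = headTail n x' y' ↔ x = x' ∧ y = y' := by
  obtain ⟨k, l, h⟩ := exists_headTail hn
  refine ⟨fun e => ⟨?_, ?_⟩, by rintro ⟨rfl, rfl⟩; rfl⟩
  · rw [← (h A x y).1, e, (h A x' y').1]
  · rw [← (h A x y).2, e, (h A x' y').2]

end Basic

/-! ### Finitely many non-unary relations: representing an ideal -/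

section Representability

variable {I : Type u} {μ : I → ℕ+}

/-- If only finitely many relations are not unary, an ideal `J` is the age of a limit of its members
along an ultrafilter `U` on `J` that contains every cone `{t | s ≤ t}`. After the choice of an
embedding of `s` into `t` for all `s ≤ t` in `J`, a point of the limit is a point `a` of some `s`,
and such points are identified when their images in `t` agree for `U`-almost all `t`. A point keeps
its unary relations all along, so a finite part of the limit is described, within some cone, by
finitely many conditions. This is why the whole ultraproduct is not used: its other points can
satisfy combinations of unary relations that no point of a member of `J` satisfies. -/
theorem isRepresentable_of_finite (hμ : (μ ⁻¹' {n : ℕ+ | n ≠ 1}).Finite) {J : Set (FinIsoType μ)}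
    (hJ : Order.IsIdeal J) : IsRepresentable J := by
  classical
  rw [isRepresentable_iff]
  have : Nonempty J := hJ.Nonempty.to_subtype
  have : IsDirectedOrder J := ⟨fun a b =>
    let ⟨c, hc, hac, hbc⟩ := hJ.Directed a a.2 b b.2
    ⟨⟨c, hc⟩, hac, hbc⟩⟩
  let U : Ultrafilter J := Ultrafilter.of Filter.atTop
  have hU (s : J) : ∀ᶠ t in (U : Filter J), s ≤ t :=
    Ultrafilter.of_le Filter.atTop (Filter.eventually_ge_atTop s)
  choose E hE using fun s : J => s.1.exists_isoType_eq
  have hemb (s t : J) (h : s ≤ t) : ∃ f, IsEmb (E s).rel (E t).rel f := by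
    rw [← FinStr.isoType_le_iff, hE, hE]
    exact h
  choose e he using hemb
  -- The image of the point `σ` in `E t`, which is `none` outside the cone of `σ`.
  let ev (σ : Σ s : J, (E s).Carrier) (t : J) : Option (E t).Carrier :=
    if h : σ.1 ≤ t then some (e σ.1 t h σ.2) else none
  have hev (σ : Σ s : J, (E s).Carrier) (t : J) (h : σ.1 ≤ t) :
      ev σ t = some (e σ.1 t h σ.2) := dif_pos h
  let r : Setoid (Σ s : J, (E s).Carrier) :=
    { r := fun σ τ => ∀ᶠ t in (U : Filter J), ev σ t = ev τ t
      iseqv := ⟨fun _ => .of_forall fun _ => rfl, fun h => h.mono fun _ h => h.symm,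
        fun h h' => (h.and h').mono fun _ h => h.1.trans h.2⟩ }
  have hout (σ : Σ s : J, (E s).Carrier) :
      ∀ᶠ t in (U : Filter J), ev (Quotient.mk r σ).out t = ev σ t := Quotient.mk_out (s := r) σ
  let P (t : J) (i : I) (v : Fin (μ i) → Quotient r) : Prop :=
    ∃ b, (∀ k, ev (v k).out t = some (b k)) ∧ (E t).rel i b
  have hP (t : J) (i : I) (v : Fin (μ i) → Quotient r) (b : Fin (μ i) → (E t).Carrier)
      (hb : ∀ k, ev (v k).out t = some (b k)) : P t i v ↔ (E t).rel i b := by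
    refine ⟨?_, fun h => ⟨b, hb, h⟩⟩
    rintro ⟨b', hb', h⟩
    have : b' = b := funext fun k => Option.some_injective _ ((hb' k).symm.trans (hb k))
    rwa [← this]
  refine ⟨Quotient r, fun i v => ∀ᶠ t in (U : Filter J), P t i v, fun S => ⟨fun hS => ?_, ?_⟩⟩
  · -- Sending `a` to the class of `(s, a)` embeds `E s`, and `S` is isomorphic to `E s`.
    let s : J := ⟨S.isoType, hS⟩
    obtain ⟨j, hj⟩ := FinStr.isoType_le_iff.1 (hE s).ge
    refine ⟨_, IsEmb.comp (g := fun x => Quotient.mk r ⟨s, x⟩) ⟨fun x y hxy => ?_, fun i v => ?_⟩ hj⟩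
    · obtain ⟨t, ht, hst⟩ := ((Quotient.exact hxy : _).and (hU s)).exists
      rw [hev ⟨s, x⟩ t hst, hev ⟨s, y⟩ t hst] at ht
      exact (he s t hst).1 (Option.some_injective _ ht)
    · have h1 : ∀ᶠ t in (U : Filter J),
          (P t i ((fun x => Quotient.mk r ⟨s, x⟩) ∘ v) ↔ (E s).rel i v) := by
        filter_upwards [hU s, Filter.eventually_all.2 fun x => hout ⟨s, x⟩] with t hst ht
        rw [← (he s t hst).2 i v]
        exact hP t i _ _ fun k => (ht (v k)).trans (hev ⟨s, v k⟩ t hst)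
      exact (Filter.eventually_congr h1).trans Filter.eventually_const
  · -- Almost every member of `J` contains a copy of a given finite part of the limit.
    rintro ⟨h, hinj, hrel⟩
    have : Finite (μ ⁻¹' {n : ℕ+ | n ≠ 1}) := hμ.to_subtype
    have h1 : ∀ᶠ t in (U : Filter J), ∀ x, (h x).out.1 ≤ t :=
      Filter.eventually_all.2 fun x => hU _
    have h2 : ∀ᶠ t in (U : Filter J), ∀ x y, ev (h x).out t = ev (h y).out t → x = y := by
      refine Filter.eventually_all.2 fun x => Filter.eventually_all.2 fun y => ?_
      rw [Ultrafilter.eventually_imp, Filter.eventually_const]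
      intro hxy
      apply hinj
      rw [← Quotient.out_eq (h x), ← Quotient.out_eq (h y)]
      exact Quotient.sound (s := r) hxy
    have h3 : ∀ᶠ t in (U : Filter J), ∀ (i : μ ⁻¹' {n : ℕ+ | n ≠ 1}) (v : Fin (μ i) → S.Carrier),
        (P t i (h ∘ v) ↔ S.rel i v) := by
      refine Filter.eventually_all.2 fun i => Filter.eventually_all.2 fun v => ?_
      rw [← hrel]
      by_cases hc : ∀ᶠ t in (U : Filter J), P t i (h ∘ v)
      · exact hc.mono fun t ht => iff_of_true ht hc
      · exact (Ultrafilter.eventually_not.2 hc).mono fun t ht => iff_of_false ht hc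
    obtain ⟨t, ht1, ht2, ht3⟩ := (h1.and (h2.and h3)).exists
    have hb (t : J) (ht : ∀ x, (h x).out.1 ≤ t) (i : I) (v : Fin (μ i) → S.Carrier) :=
      hP t i (h ∘ v) (fun k => e _ t (ht (v k)) (h (v k)).out.2) fun k => hev _ t (ht (v k))
    suffices S.isoType ≤ t from hJ.IsLowerSet this t.2
    rw [← hE t, FinStr.isoType_le_iff]
    refine ⟨fun x => e _ t (ht1 x) (h x).out.2, fun x y hxy => ht2 x y ?_, fun i v => ?_⟩
    · rw [hev _ t (ht1 x), hev _ t (ht1 y)]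
      exact congrArg some hxy
    · by_cases hi : μ i = 1
      · -- A unary relation is decided at the index where the element is born.
        obtain ⟨x, rfl⟩ := exists_eq_const hi v
        have hc (t : J) (ht : ∀ x, (h x).out.1 ≤ t) :
            P t i (h ∘ fun _ => x) ↔ (E _).rel i fun _ => (h x).out.2 :=
          (hb t ht i fun _ => x).trans ((he _ t (ht x)).2 i fun _ => (h x).out.2)
        have hc' : S.rel i (fun _ => x) ↔ (E _).rel i fun _ => (h x).out.2 :=
          (hrel i _).symm.trans
            ((Filter.eventually_congr (h1.mono hc)).trans Filter.eventually_const)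
        rw [hc', ← hc t ht1]
        exact (hb t ht1 i fun _ => x).symm
      · exact (hb t ht1 i v).symm.trans (ht3 ⟨i, hi⟩ v)

end Representability

/-! ### Infinitely many non-unary relations: an ideal that is not an age -/

section Nonrepresentability

variable {I : Type u} {μ : I → ℕ+}

/-- The structures in which the pairs of distinct points are properly edge-coloured: each ordered
pair `(x, y)` with `x ≠ y` has a colour, the only index `i` of arity at least `2` for which the
tuple `(x, y, …, y)` is in the relation `i`, and the pairs that start at the same point have
different colours. -/
structure IsProperlyColored {A : Type w} (R : RelFam μ A) : Prop where
  existsUnique : ∀ x y, x ≠ y → ∃! i, μ i ≠ 1 ∧ R i (headTail (μ i) x y)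
  eq_of_rel : ∀ i, μ i ≠ 1 → ∀ x y z, x ≠ y → x ≠ z → R i (headTail (μ i) x y) →
    R i (headTail (μ i) x z) → y = z

theorem IsEmb.isProperlyColored {A : Type w} {B : Type*} {R : RelFam μ A} {R' : RelFam μ B}
    {f : A → B} (hf : IsEmb R R' f) (h : IsProperlyColored R') : IsProperlyColored R := by
  have key (i : I) (x y : A) : R' i (headTail (μ i) (f x) (f y)) ↔ R i (headTail (μ i) x y) := by
    rw [← comp_headTail, hf.2]
  refine ⟨fun x y hxy => ?_, fun i hi x y z hxy hxz h1 h2 => ?_⟩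
  · simpa only [key] using h.existsUnique _ _ (hf.1.ne hxy)
  · exact hf.1 (h.eq_of_rel i hi _ _ _ (hf.1.ne hxy) (hf.1.ne hxz) ((key _ _ _).2 h1)
      ((key _ _ _).2 h2))

theorem isProperlyColored_of_forall_finite {A : Type w} {R : RelFam μ A}
    (h : ∀ (S : FinStr μ) (f : S.Carrier → A), IsEmb S.rel R f → IsProperlyColored S.rel) :
    IsProperlyColored R := by
  have key (x y z : A) : ∃ (S : FinStr μ) (f : S.Carrier → A) (a b c : S.Carrier),
      IsEmb S.rel R f ∧ f a = x ∧ f b = y ∧ f c = z := by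
    obtain ⟨S, f, hf, hr⟩ := exists_finStr_range_eq R (Set.toFinite {x, y, z})
    obtain ⟨a, ha⟩ : x ∈ Set.range f := by simp [hr]
    obtain ⟨b, hb⟩ : y ∈ Set.range f := by simp [hr]
    obtain ⟨c, hc⟩ : z ∈ Set.range f := by simp [hr]
    exact ⟨S, f, a, b, c, hf, ha, hb, hc⟩
  refine ⟨fun x y hxy => ?_, fun i hi x y z hxy hxz h1 h2 => ?_⟩
  · obtain ⟨S, f, a, b, -, hf, rfl, rfl, -⟩ := key x y y
    simpa only [← comp_headTail, hf.2] using
      (h S f hf).existsUnique a b fun hab => hxy (congrArg f hab)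
  · obtain ⟨S, f, a, b, c, hf, rfl, rfl, rfl⟩ := key x y z
    rw [← comp_headTail, hf.2] at h1 h2
    exact congrArg f ((h S f hf).eq_of_rel i hi a b c (fun e => hxy (congrArg f e))
      (fun e => hxz (congrArg f e)) h1 h2)

theorem IsProperlyColored.finite_colors {A : Type w} [Finite A] {R : RelFam μ A}
    (h : IsProperlyColored R) :
    {i | μ i ≠ 1 ∧ ∃ x y, x ≠ y ∧ R i (headTail (μ i) x y)}.Finite := by
  have : (⋃ (x : A) (y : A), {i | x ≠ y ∧ μ i ≠ 1 ∧ R i (headTail (μ i) x y)}).Finite := by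
    refine Set.finite_iUnion fun x => Set.finite_iUnion fun y => Set.Subsingleton.finite ?_
    rintro i ⟨hxy, hi⟩ j ⟨-, hj⟩
    exact (h.existsUnique x y hxy).unique hi hj
  refine this.subset ?_
  rintro i ⟨hi, x, y, hxy, hR⟩
  simp only [Set.mem_iUnion]
  exact ⟨x, y, hxy, hi, hR⟩

/-- The disjoint union of two structures, with the colour `g (x, y)` added on the pairs
formed by a point `x` of the first and a point `y` of the second. -/
def coloredSum {A B : Type*} (R : RelFam μ A) (R' : RelFam μ B) (g : A × B → I) :
    RelFam μ (A ⊕ B) := fun i v =>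
  (∃ a, v = Sum.inl ∘ a ∧ R i a) ∨ (∃ b, v = Sum.inr ∘ b ∧ R' i b) ∨
    ∃ x y, i = g (x, y) ∧ (v = headTail (μ i) (Sum.inl x) (Sum.inr y) ∨
      v = headTail (μ i) (Sum.inr y) (Sum.inl x))

section coloredSum

variable {A B : Type*} {R : RelFam μ A} {R' : RelFam μ B} {g : A × B → I}

theorem coloredSum_inl (hg : ∀ p, μ (g p) ≠ 1) (i : I) (a : Fin (μ i) → A) :
    coloredSum R R' g i (Sum.inl ∘ a) ↔ R i a := by
  refine ⟨?_, fun h => .inl ⟨a, rfl, h⟩⟩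
  rintro (⟨a', h, ha'⟩ | ⟨b, h, -⟩ | ⟨x, y, rfl, h⟩)
  · rwa [Sum.inl_injective.comp_left h]
  · exact absurd (congrFun h ⟨0, (μ i).pos⟩) Sum.inl_ne_inr
  · obtain ⟨k, l, hkl⟩ := exists_headTail (hg (x, y))
    rcases h with h | h
    · exact absurd ((congrFun h l).trans (hkl _ _ _).2) Sum.inl_ne_inr
    · exact absurd ((congrFun h k).trans (hkl _ _ _).1) Sum.inl_ne_inr

theorem coloredSum_inr (hg : ∀ p, μ (g p) ≠ 1) (i : I) (b : Fin (μ i) → B) :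
    coloredSum R R' g i (Sum.inr ∘ b) ↔ R' i b := by
  refine ⟨?_, fun h => .inr (.inl ⟨b, rfl, h⟩)⟩
  rintro (⟨a, h, -⟩ | ⟨b', h, hb'⟩ | ⟨x, y, rfl, h⟩)
  · exact absurd (congrFun h ⟨0, (μ i).pos⟩) Sum.inr_ne_inl
  · rwa [Sum.inr_injective.comp_left h]
  · obtain ⟨k, l, hkl⟩ := exists_headTail (hg (x, y))
    rcases h with h | h
    · exact absurd ((congrFun h k).trans (hkl _ _ _).1) Sum.inr_ne_inl
    · exact absurd ((congrFun h l).trans (hkl _ _ _).2) Sum.inr_ne_inl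

theorem coloredSum_inl_inr {i : I} (hi : μ i ≠ 1) (x : A) (y : B) :
    coloredSum R R' g i (headTail (μ i) (Sum.inl x) (Sum.inr y)) ↔ i = g (x, y) := by
  obtain ⟨k, l, hkl⟩ := exists_headTail hi
  refine ⟨?_, fun h => .inr (.inr ⟨x, y, h, .inl rfl⟩)⟩
  rintro (⟨a, h, -⟩ | ⟨b, h, -⟩ | ⟨x', y', hi', h⟩)
  · exact absurd ((hkl _ _ _).2.symm.trans (congrFun h l)) Sum.inr_ne_inl
  · exact absurd ((hkl _ _ _).1.symm.trans (congrFun h k)) Sum.inl_ne_inr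
  · simp only [headTail_inj hi, Sum.inl.injEq, Sum.inr.injEq, reduceCtorEq, and_self,
      or_false] at h
    rw [hi', h.1, h.2]

theorem coloredSum_inr_inl {i : I} (hi : μ i ≠ 1) (x : A) (y : B) :
    coloredSum R R' g i (headTail (μ i) (Sum.inr y) (Sum.inl x)) ↔ i = g (x, y) := by
  obtain ⟨k, l, hkl⟩ := exists_headTail hi
  refine ⟨?_, fun h => .inr (.inr ⟨x, y, h, .inr rfl⟩)⟩
  rintro (⟨a, h, -⟩ | ⟨b, h, -⟩ | ⟨x', y', hi', h⟩)
  · exact absurd ((hkl _ _ _).1.symm.trans (congrFun h k)) Sum.inr_ne_inl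
  · exact absurd ((hkl _ _ _).2.symm.trans (congrFun h l)) Sum.inl_ne_inr
  · simp only [headTail_inj hi, Sum.inl.injEq, Sum.inr.injEq, reduceCtorEq, and_self,
      false_or] at h
    rw [hi', h.1, h.2]

theorem isProperlyColored_coloredSum (hR : IsProperlyColored R) (hR' : IsProperlyColored R')
    (hinj : Function.Injective g) (hg : ∀ p, μ (g p) ≠ 1)
    (hgR : ∀ p x y, x ≠ y → ¬ R (g p) (headTail _ x y))
    (hgR' : ∀ p x y, x ≠ y → ¬ R' (g p) (headTail _ x y)) :
    IsProperlyColored (coloredSum R R' g) := by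
  have hll (i : I) (x y : A) :
      coloredSum R R' g i (headTail (μ i) (Sum.inl x) (Sum.inl y)) ↔
        R i (headTail (μ i) x y) := by
    rw [← comp_headTail, coloredSum_inl hg]
  have hrr (i : I) (x y : B) :
      coloredSum R R' g i (headTail (μ i) (Sum.inr x) (Sum.inr y)) ↔
        R' i (headTail (μ i) x y) := by
    rw [← comp_headTail, coloredSum_inr hg]
  constructor
  · rintro (x | x) (y | y) hxy
    · simpa only [hll] using hR.existsUnique x y fun h => hxy (congrArg _ h)
    · exact ⟨g (x, y), ⟨hg _, (coloredSum_inl_inr (hg _) x y).2 rfl⟩,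
        fun i hi => (coloredSum_inl_inr hi.1 x y).1 hi.2⟩
    · exact ⟨g (y, x), ⟨hg _, (coloredSum_inr_inl (hg _) y x).2 rfl⟩,
        fun i hi => (coloredSum_inr_inl hi.1 y x).1 hi.2⟩
    · simpa only [hrr] using hR'.existsUnique x y fun h => hxy (congrArg _ h)
  · rintro i hi (x | x) (y | y) (z | z) hxy hxz h1 h2 <;>
      simp only [hll, hrr, coloredSum_inl_inr hi, coloredSum_inr_inl hi] at h1 h2
    · exact congrArg _ (hR.eq_of_rel i hi x y z (fun h => hxy (congrArg _ h))
        (fun h => hxz (congrArg _ h)) h1 h2)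
    · subst h2
      exact absurd h1 (hgR _ _ _ fun h => hxy (congrArg _ h))
    · subst h1
      exact absurd h2 (hgR _ _ _ fun h => hxz (congrArg _ h))
    · exact congrArg _ (Prod.ext_iff.1 (hinj (h1.symm.trans h2))).2
    · exact congrArg _ (Prod.ext_iff.1 (hinj (h1.symm.trans h2))).1
    · subst h1
      exact absurd h2 (hgR' _ _ _ fun h => hxz (congrArg _ h))
    · subst h2
      exact absurd h1 (hgR' _ _ _ fun h => hxy (congrArg _ h))
    · exact congrArg _ (hR'.eq_of_rel i hi x y z (fun h => hxy (congrArg _ h))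
        (fun h => hxz (congrArg _ h)) h1 h2)

end coloredSum

/-- The isomorphism types of the finite properly coloured structures. -/
def properlyColoredTypes (μ : I → ℕ+) : Set (FinIsoType μ) :=
  {s | ∃ S : FinStr μ, S.isoType = s ∧ IsProperlyColored S.rel}

theorem isoType_mem_properlyColoredTypes {S : FinStr μ} :
    S.isoType ∈ properlyColoredTypes μ ↔ IsProperlyColored S.rel := by
  refine ⟨?_, fun h => ⟨S, rfl, h⟩⟩
  rintro ⟨T, hTS, hT⟩
  obtain ⟨f, hf⟩ := FinStr.isoType_le_iff.1 hTS.ge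
  exact hf.isProperlyColored hT

/-- Two finite properly coloured structures use finitely many colours, so an infinite supply of
colours leaves enough new ones for the pairs across their disjoint union. -/
theorem isIdeal_properlyColoredTypes (hμ : (μ ⁻¹' {n : ℕ+ | n ≠ 1}).Infinite) :
    Order.IsIdeal (properlyColoredTypes μ) := by
  refine ⟨fun t s hst ht => ?_, ?_, fun s hs t ht => ?_⟩
  · obtain ⟨S, rfl⟩ := s.exists_isoType_eq
    obtain ⟨T, rfl⟩ := t.exists_isoType_eq
    rw [isoType_mem_properlyColoredTypes] at ht ⊢
    obtain ⟨f, hf⟩ := FinStr.isoType_le_iff.1 hst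
    exact hf.isProperlyColored ht
  · obtain ⟨S, e, -, he⟩ := exists_finStr (μ := μ) (A := Empty) fun _ _ => False
    exact ⟨S.isoType, S, rfl, he.isProperlyColored ⟨fun x => x.elim, fun _ _ x => x.elim⟩⟩
  · obtain ⟨S, rfl, hS⟩ := hs
    obtain ⟨T, rfl, hT⟩ := ht
    have hN := (hμ.sdiff hS.finite_colors).sdiff hT.finite_colors
    let j₁ := hN.natEmbedding
    obtain ⟨n, ⟨j⟩⟩ := Finite.exists_equiv_fin (S.Carrier × T.Carrier)
    let g : S.Carrier × T.Carrier → I := fun p => j₁ (j p).val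
    have hinj : Function.Injective g := Subtype.val_injective.comp
      (j₁.injective.comp (Fin.val_injective.comp j.injective))
    have hgmem (p) : g p ∈ _ := (j₁ (j p).val).2
    have hg (p) : μ (g p) ≠ 1 := (hgmem p).1.1
    obtain ⟨V, e, he, he'⟩ := exists_finStr (coloredSum S.rel T.rel g)
    refine ⟨V.isoType, ⟨V, rfl, he'.isProperlyColored (isProperlyColored_coloredSum hS hT hinj hg
      (fun p x y hxy h => (hgmem p).1.2 ⟨hg p, x, y, hxy, h⟩)
      (fun p x y hxy h => (hgmem p).2 ⟨hg p, x, y, hxy, h⟩))⟩, ?_, ?_⟩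
    · exact FinStr.isoType_le_iff.2 ⟨_, he.comp ⟨Sum.inl_injective, coloredSum_inl hg⟩⟩
    · exact FinStr.isoType_le_iff.2 ⟨_, he.comp ⟨Sum.inr_injective, coloredSum_inr hg⟩⟩

/-- With `κ` colours, a properly coloured structure has at most `1 + κ` points, but the
one-point structures alone require `2 ^ κ` of them. -/
theorem not_isRepresentable_properlyColoredTypes (hμ : (μ ⁻¹' {n : ℕ+ | n ≠ 1}).Infinite) :
    ¬ IsRepresentable (properlyColoredTypes μ) := by
  classical
  rw [isRepresentable_iff]
  rintro ⟨A, R, hA⟩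
  have hR : IsProperlyColored R := isProperlyColored_of_forall_finite fun S f hf =>
    isoType_mem_properlyColoredTypes.1 ((hA S).2 ⟨f, hf⟩)
  let N : Type u := μ ⁻¹' {n : ℕ+ | n ≠ 1}
  have : Infinite N := hμ.to_subtype
  have hpt (C : Set N) : ∃ x : A, ∀ i : N, R i (fun _ => x) ↔ i ∈ C := by
    obtain ⟨S, e, he, he'⟩ := exists_finStr (μ := μ) (A := Unit) fun i _ => ∃ h, ⟨i, h⟩ ∈ C
    obtain ⟨f, hf⟩ := (hA S).1 ⟨S, rfl, he'.isProperlyColored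
      ⟨fun x y h => (h rfl).elim, fun _ _ x y _ h => (h rfl).elim⟩⟩
    refine ⟨f (e ()), fun i => ((hf.comp he).2 i fun _ => ()).trans ?_⟩
    exact ⟨fun ⟨_, h⟩ => h, fun h => ⟨i.2, h⟩⟩
  choose φ hφ using hpt
  have hφinj : Function.Injective φ := fun C D h => Set.ext fun i => by rw [← hφ, ← hφ, h]
  -- Any point would do as the common start of the pairs whose colours separate the points of `A`.
  let x₀ := φ ∅
  have hcol (y : A) (h : x₀ ≠ y) : ∃ i : N, R i (headTail (μ i) x₀ y) :=
    let ⟨i, hi, _⟩ := hR.existsUnique x₀ y h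
    ⟨⟨i, hi.1⟩, hi.2⟩
  choose c hc using hcol
  let ℓ (y : A) : Option N := if h : x₀ = y then none else some (c y h)
  have hℓ : Function.Injective ℓ := by
    intro y z hyz
    by_cases hy : x₀ = y
    · by_contra hne
      have hz : x₀ ≠ z := fun hz => hne (hy.symm.trans hz)
      simp only [ℓ, dif_pos hy, dif_neg hz, reduceCtorEq] at hyz
    · have hz : x₀ ≠ z := fun hz => by
        simp only [ℓ, dif_neg hy, dif_pos hz, reduceCtorEq] at hyz
      simp only [ℓ, dif_neg hy, dif_neg hz, Option.some.injEq] at hyz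
      have h1 := hc y hy
      rw [hyz] at h1
      exact hR.eq_of_rel _ (c z hz).2 _ _ _ hy hz h1 (hc z hz)
  have hcard : Cardinal.mk (Option N) = Cardinal.mk N := by
    rw [Cardinal.mk_option, Cardinal.add_one_eq (Cardinal.aleph0_le_mk N)]
  obtain ⟨j⟩ := Cardinal.eq.1 hcard
  exact Function.cantor_injective _ (j.injective.comp (hℓ.comp hφinj))

end Nonrepresentability

/-! ### Compactness of the set of ideals -/

section Compactness

open Topology

theorem isCompact_powerset_iff {P : Type w} (p : Set P → Prop) :
    @IsCompact (Set P) (powersetTopology P) {X | p X} ↔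
      IsClosed {φ : P → Bool | p {x | φ x = true}} := by
  classical
  let := powersetTopology P
  have hind : IsInducing (fun (X : Set P) (x : P) => decide (x ∈ X)) := by
    refine ⟨?_⟩
    change TopologicalSpace.induced _ _ = _
    congr!
  suffices himage : (fun (X : Set P) (x : P) => decide (x ∈ X)) '' {X | p X} =
      {φ : P → Bool | p {x | φ x = true}} by
    rw [hind.isCompact_iff, himage]
    exact ⟨IsCompact.isClosed, IsClosed.isCompact⟩
  ext φ
  constructor
  · rintro ⟨X, hX, rfl⟩
    simpa using hX
  · exact fun h => ⟨_, h, by simp⟩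

variable {I : Type u} {μ : I → ℕ+}

/-- The data that determine the structure covered by two embeddings of `S` and `T`: the kernel of
the map `p` on the disjoint union, and the relations of arity at least `2` pulled back along it. -/
def jointDiagram {A W : Type*} (R : RelFam μ A) (p : W → A) :
    (W → W → Prop) × ((i : μ ⁻¹' {n : ℕ+ | n ≠ 1}) → (Fin (μ i) → W) → Prop) :=
  (fun a b => p a = p b, fun i v => R i (p ∘ v))

/-- Each upper bound of `S` and `T` lies above one that is covered by a copy of `S` and a copy of
`T`, and there are only finitely many of those if finitely many relations are not unary. -/
theorem exists_finite_upperBounds (hμ : (μ ⁻¹' {n : ℕ+ | n ≠ 1}).Finite) (s t : FinIsoType μ) :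
    ∃ E : Set (FinIsoType μ), E.Finite ∧ (∀ e ∈ E, s ≤ e ∧ t ≤ e) ∧
      ∀ u, s ≤ u → t ≤ u → ∃ e ∈ E, e ≤ u := by
  obtain ⟨S, rfl⟩ := s.exists_isoType_eq
  obtain ⟨T, rfl⟩ := t.exists_isoType_eq
  have : Finite (μ ⁻¹' {n : ℕ+ | n ≠ 1}) := hμ.to_subtype
  let W := S.Carrier ⊕ T.Carrier
  -- `V` is covered by a copy of `S` and a copy of `T`.
  let IsJoint (V : FinStr μ) (p : W → V.Carrier) : Prop := Function.Surjective p ∧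
    IsEmb S.rel V.rel (p ∘ Sum.inl) ∧ IsEmb T.rel V.rel (p ∘ Sum.inr)
  have hle (V V' : FinStr μ) (p : W → V.Carrier) (p' : W → V'.Carrier) (h : IsJoint V p)
      (h' : IsJoint V' p') (hc : jointDiagram V.rel p = jointDiagram V'.rel p') :
      V.isoType ≤ V'.isoType := by
    have hker (a b : W) : p a = p b ↔ p' a = p' b :=
      iff_of_eq (congrFun₂ (congrArg Prod.fst hc) a b)
    have hrel (i : I) (w : Fin (μ i) → W) : V'.rel i (p' ∘ w) ↔ V.rel i (p ∘ w) := by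
      by_cases hi : μ i = 1
      · -- A unary relation of the joint structure is determined by `S` and `T`.
        obtain ⟨x, rfl⟩ := exists_eq_const hi w
        rcases x with x | x
        · exact (h'.2.1.2 i fun _ => x).trans (h.2.1.2 i fun _ => x).symm
        · exact (h'.2.2.2 i fun _ => x).trans (h.2.2.2 i fun _ => x).symm
      · exact (iff_of_eq (congrFun₂ (congrArg Prod.snd hc) ⟨i, hi⟩ w)).symm
    obtain ⟨q, hq⟩ := h.1.hasRightInverse
    refine FinStr.isoType_le_iff.2 ⟨p' ∘ q, fun a b hab => ?_, fun i v => ?_⟩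
    · rw [← hq a, ← hq b]
      exact (hker _ _).2 hab
    · refine (hrel i (q ∘ v)).trans ?_
      rw [← Function.comp_assoc, hq.comp_eq_id, Function.id_comp]
  let Is (c) (e : FinIsoType μ) : Prop :=
    ∃ V p, IsJoint V p ∧ jointDiagram V.rel p = c ∧ V.isoType = e
  refine ⟨⋃ c, {e | Is c e}, Set.finite_iUnion fun c => Set.Subsingleton.finite ?_, ?_, ?_⟩
  · rintro _ ⟨V, p, h, hc, rfl⟩ _ ⟨V', p', h', hc', rfl⟩
    exact le_antisymm (hle _ _ _ _ h h' (hc.trans hc'.symm)) (hle _ _ _ _ h' h (hc'.trans hc.symm))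
  · intro e he
    obtain ⟨c, V, p, h, -, rfl⟩ := Set.mem_iUnion.1 he
    exact ⟨FinStr.isoType_le_iff.2 ⟨_, h.2.1⟩, FinStr.isoType_le_iff.2 ⟨_, h.2.2⟩⟩
  · intro u hs ht
    obtain ⟨X, rfl⟩ := u.exists_isoType_eq
    obtain ⟨f, hf⟩ := FinStr.isoType_le_iff.1 hs
    obtain ⟨g, hg⟩ := FinStr.isoType_le_iff.1 ht
    obtain ⟨V, m, hm, hr⟩ := exists_finStr_range_eq X.rel (Set.finite_range (Sum.elim f g))
    have hp (w : W) : ∃ a, m a = Sum.elim f g w := by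
      rw [← Set.mem_range, hr]
      exact ⟨w, rfl⟩
    choose p hp using hp
    have hpf : m ∘ p ∘ Sum.inl = f := funext fun x => hp (Sum.inl x)
    have hpg : m ∘ p ∘ Sum.inr = g := funext fun x => hp (Sum.inr x)
    refine ⟨V.isoType, Set.mem_iUnion.2 ⟨_, V, p, ⟨fun a => ?_, ?_, ?_⟩, rfl, rfl⟩,
      FinStr.isoType_le_iff.2 ⟨m, hm⟩⟩
    · obtain ⟨w, hw⟩ : m a ∈ Set.range (Sum.elim f g) := hr ▸ ⟨a, rfl⟩
      exact ⟨w, hm.1 ((hp w).trans hw)⟩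
    · rw [← hpf] at hf
      exact ⟨hf.1.of_comp, fun i v => (hm.2 i _).symm.trans (hf.2 i v)⟩
    · rw [← hpg] at hg
      exact ⟨hg.1.of_comp, fun i v => (hm.2 i _).symm.trans (hg.2 i v)⟩

/-- Being a lower set is a closed condition; containing the empty structure is one as well; and
when a pair has a finite complete set of upper bounds, so is being directed for that pair. -/
theorem isClosed_isIdeal (hμ : (μ ⁻¹' {n : ℕ+ | n ≠ 1}).Finite) :
    IsClosed {φ : FinIsoType μ → Bool | Order.IsIdeal {s | φ s = true}} := by
  choose E hEfin hEub hEmin using exists_finite_upperBounds (μ := μ) hμ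
  obtain ⟨O, e, heO, -⟩ := exists_finStr (μ := μ) (A := Empty) fun _ _ => False
  have hO (s : FinIsoType μ) : O.isoType ≤ s := by
    obtain ⟨S, rfl⟩ := s.exists_isoType_eq
    have : IsEmpty O.Carrier := e.symm.isEmpty
    refine FinStr.isoType_le_iff.2 ⟨isEmptyElim, fun x => isEmptyElim x, fun i v => ?_⟩
    exact isEmptyElim (v ⟨0, (μ i).pos⟩)
  have hclopen (s : FinIsoType μ) : IsClopen {φ : FinIsoType μ → Bool | φ s = true} :=
    (isClopen_discrete {true}).preimage (continuous_apply s)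
  have heq : {φ : FinIsoType μ → Bool | Order.IsIdeal {s | φ s = true}} =
      {φ | φ O.isoType = true} ∩ ((⋂ (t) (s) (_ : s ≤ t), {φ | φ t = true → φ s = true}) ∩
        ⋂ (s) (t), {φ | φ s = true → φ t = true → φ ∈ ⋃ e ∈ E s t, {φ | φ e = true}}) := by
    ext φ
    simp only [Set.mem_inter_iff, Set.mem_iInter, Set.mem_iUnion, Set.mem_ofPred_eq, exists_prop]
    constructor
    · rintro ⟨h1, ⟨s, hs⟩, h3⟩
      refine ⟨h1 (hO s) hs, fun t s hst ht => h1 hst ht, fun s t hs ht => ?_⟩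
      obtain ⟨u, hu, hsu, htu⟩ := h3 s hs t ht
      obtain ⟨e, he, heu⟩ := hEmin s t u hsu htu
      exact ⟨e, he, h1 heu hu⟩
    · rintro ⟨h1, h2, h3⟩
      refine ⟨fun t s hst ht => h2 t s hst ht, ⟨_, h1⟩, fun s hs t ht => ?_⟩
      obtain ⟨e, he, hφe⟩ := h3 s t hs ht
      exact ⟨e, hφe, hEub s t e he⟩
  rw [heq]
  refine (hclopen _).1.inter (IsClosed.inter ?_ ?_)
  · exact isClosed_iInter fun t => isClosed_iInter fun s => isClosed_iInter fun _ =>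
      isClosed_imp (hclopen t).2 (hclopen s).1
  · exact isClosed_iInter fun s => isClosed_iInter fun t => isClosed_imp (hclopen s).2
      (isClosed_imp (hclopen t).2 ((hEfin s t).isClosed_biUnion fun e _ => (hclopen e).1))

/-- The structure on `Bool` in which no relation holds on constant tuples of `false`, all relations
hold on constant tuples of `true`, and a non-constant tuple is only in the relation `i`. -/
def twoPoint (μ : I → ℕ+) (i : I) : RelFam μ Bool := fun k v =>
  (∀ m, v m = true) ∨ (k = i ∧ ∃ m m', v m ≠ v m')

theorem twoPoint_const (i k : I) (b : Bool) : twoPoint μ i k (fun _ => b) ↔ b = true := by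
  have : Nonempty (Fin (μ k)) := ⟨⟨0, (μ k).pos⟩⟩
  simp [twoPoint]

theorem isEmb_twoPoint_const {X : Type*} {R : RelFam μ X} {i : I} {f : X → Bool}
    (hf : IsEmb R (twoPoint μ i) f) (hconst : ∀ a b, f a = f b) (k : I) :
    IsEmb R (twoPoint μ k) f := by
  refine ⟨hf.1, fun l v => ?_⟩
  have (j : I) : twoPoint μ j l (f ∘ v) ↔ ∀ m, f (v m) = true :=
    or_iff_left fun ⟨_, m, m', h⟩ => h (hconst _ _)
  rw [← hf.2 l v, this, this]

/-- The types of the points are read off from the structure, so two embeddings into two-point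
structures agree; and only one two-point structure has a given type of the pair. -/
theorem eq_of_isEmb_twoPoint {X : Type*} {R : RelFam μ X} {i j : I} (hi : μ i ≠ 1) (hij : i ≠ j)
    {f g : X → Bool} (hf : IsEmb R (twoPoint μ i) f) (hg : IsEmb R (twoPoint μ j) g) (a b : X) :
    f a = f b := by
  have hfg (a : X) : f a = g a := Bool.eq_iff_iff.2 <| by
    rw [← twoPoint_const (μ := μ) i i, ← twoPoint_const (μ := μ) j i]
    exact (hf.2 i fun _ => a).trans (hg.2 i fun _ => a).symm
  by_contra hab
  obtain ⟨k, l, hkl⟩ := exists_headTail hi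
  have h1 : twoPoint μ i i (f ∘ headTail (μ i) a b) := by
    refine .inr ⟨rfl, k, l, ?_⟩
    rwa [comp_headTail, (hkl _ _ _).1, (hkl _ _ _).2]
  rw [hf.2, ← hg.2] at h1
  rcases h1 with h1 | ⟨h1, -⟩
  · rw [comp_headTail] at h1
    have hk := h1 k
    have hl := h1 l
    rw [(hkl _ _ _).1] at hk
    rw [(hkl _ _ _).2] at hl
    exact hab (by rw [hfg, hfg, hk, hl])
  · exact hij h1

/-- The principal ideals generated by the two-point structures converge to the set of the types that
embed in all of them; it contains both points, but no upper bound of them. -/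
theorem not_isClosed_isIdeal (hμ : (μ ⁻¹' {n : ℕ+ | n ≠ 1}).Infinite) :
    ¬ IsClosed {φ : FinIsoType μ → Bool | Order.IsIdeal {s | φ s = true}} := by
  classical
  intro hcl
  let N : Type u := μ ⁻¹' {n : ℕ+ | n ≠ 1}
  have : Infinite N := hμ.to_subtype
  choose T e he he' using fun i : N => exists_finStr (twoPoint μ i)
  have hle (S : FinStr μ) (i : N) :
      S.isoType ≤ (T i).isoType ↔ ∃ f, IsEmb S.rel (twoPoint μ i) f := by
    rw [FinStr.isoType_le_iff]
    exact ⟨fun ⟨f, hf⟩ => ⟨_, (he' i).comp hf⟩, fun ⟨f, hf⟩ => ⟨_, (he i).comp hf⟩⟩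
  have htend : Filter.Tendsto (fun (i : N) s => decide (s ≤ (T i).isoType)) Filter.cofinite
      (𝓝 fun s => decide (∀ i, s ≤ (T i).isoType)) := by
    refine tendsto_pi_nhds.2 fun s => tendsto_nhds_of_eventually_eq ?_
    simp only [decide_eq_decide]
    obtain ⟨S, rfl⟩ := s.exists_isoType_eq
    by_cases hS : ∀ i, S.isoType ≤ (T i).isoType
    · exact .of_forall fun i => iff_of_true (hS i) hS
    · refine Filter.eventually_cofinite.2 (Set.Subsingleton.finite fun i hi j hj => ?_)
      by_contra hij
      have mem {i : N} (hi : ¬ (S.isoType ≤ (T i).isoType ↔ ∀ i, S.isoType ≤ (T i).isoType)) :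
          S.isoType ≤ (T i).isoType := by
        by_contra h
        exact hi (iff_of_false h hS)
      obtain ⟨f, hf⟩ := (hle S i).1 (mem hi)
      obtain ⟨g, hg⟩ := (hle S j).1 (mem hj)
      exact hS fun k => (hle S k).2 ⟨f, isEmb_twoPoint_const hf
        (eq_of_isEmb_twoPoint i.2 (fun h => hij (Subtype.ext h)) hf hg) k⟩
  have hlim : Order.IsIdeal {s : FinIsoType μ | ∀ i : N, s ≤ (T i).isoType} := by
    have := hcl.mem_of_tendsto htend (.of_forall fun i => by
      simpa using! (Order.Ideal.principal (T i).isoType).isIdeal)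
    simpa using this
  have hpt (b : Bool) : ∃ S : FinStr μ, (∀ i : N, S.isoType ≤ (T i).isoType) ∧
      ∃ x : S.Carrier, ∀ k, S.rel k (fun _ => x) ↔ b = true := by
    obtain ⟨S, e, he, he'⟩ := exists_finStr (μ := μ) (A := Unit) fun _ _ => b = true
    refine ⟨S, fun i => (hle S i).2 ⟨_, IsEmb.comp (g := fun _ : Unit => b) ?_ he'⟩, e (),
      fun k => he.2 k fun _ => ()⟩
    exact ⟨fun _ _ _ => rfl, fun k v => twoPoint_const (μ := μ) i k b⟩
  obtain ⟨S, hS, x, hx⟩ := hpt true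
  obtain ⟨S', hS', x', hx'⟩ := hpt false
  obtain ⟨u, hu, hSu, hSu'⟩ := hlim.Directed _ hS _ hS'
  obtain ⟨V, rfl⟩ := u.exists_isoType_eq
  obtain ⟨g, hg⟩ := FinStr.isoType_le_iff.1 hSu
  obtain ⟨g', hg'⟩ := FinStr.isoType_le_iff.1 hSu'
  obtain ⟨i, j, hij⟩ := exists_pair_ne N
  obtain ⟨f, hf⟩ := (hle V i).1 (hu i)
  obtain ⟨f', hf'⟩ := (hle V j).1 (hu j)
  have h1 : f (g x) = true := by
    rw [← twoPoint_const (μ := μ) i i]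
    exact ((hf.comp hg).2 i fun _ => x).trans (hx i) |>.2 rfl
  have h2 : ¬ f (g' x') = true := by
    rw [← twoPoint_const (μ := μ) i i]
    exact fun h => Bool.false_ne_true (((hf.comp hg').2 i fun _ => x').trans (hx' i) |>.1 h)
  rw [eq_of_isEmb_twoPoint i.2 (fun h => hij (Subtype.ext h)) hf hf' (g' x') (g x)] at h2
  exact h2 h1

end Compactness

theorem theorem1 {I : Type u} (μ : I → ℕ+) :
    List.TFAE [
      ∀ J : Set (FinIsoType μ), Order.IsIdeal J → IsRepresentable J,
      (μ ⁻¹' {n : ℕ+ | n ≠ 1}).Finite,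
      @IsCompact (Set (FinIsoType μ)) (powersetTopology (FinIsoType μ))
        {J : Set (FinIsoType μ) | Order.IsIdeal J}] := by
  tfae_have 1 → 2 := fun h => by
    by_contra hμ
    exact not_isRepresentable_properlyColoredTypes hμ (h _ (isIdeal_properlyColoredTypes hμ))
  tfae_have 2 → 1 := fun h J hJ => isRepresentable_of_finite h hJ
  tfae_have 2 → 3 := fun h => (isCompact_powerset_iff _).2 (isClosed_isIdeal h)
  tfae_have 3 → 2 := fun h => by
    by_contra hμ
    exact not_isClosed_isIdeal hμ ((isCompact_powerset_iff _).1 h)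
  tfae_finish
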